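/- Let $n$ be an even positive integer that has an odd prime divisor, and let $X_n$ be the unitary Cayley graph: its vertex set is $\mathbb{Z}/n\mathbb{Z}$, and distinct vertices $a,b$ are adjacent if and only if $\gcd(a-b,n)=1$. Let $\varphi$ be Euler's function, let $p_1,\dots,p_k$ be the distinct prime divisors of $n$, let $m=p_1p_2\cdots p_k$, and let $$c(r,n)=\sum_{\substack{1\le a\le n\\ \gcd(a,n)=1}} e^{2\pi i a r/n}$$ be Ramanujan's sum. The distance spectrum of a connected graph is the multiset of eigenvalues (with multiplicities) of its distance matrix $[d(i,j)]$, the distance spectral radius is the largest absolute value of such an eigenvalue, and the distance energy $DE$ is the sum of the absolute values of these eigenvalues. Then: 1. $X_n$ has diameter $3$, and there are exactly $\varphi(n)$ vertices at distance $1$, exactly $\frac n2-1$ vertices at distance $2$ and exactly $\frac n2-\varphi(n)$ vertices at distance $3$ from the vertex $0$. 2. The distance spectrum of $X_n$ consists, with multiplicities, of $$\frac{5n}{2}-2(\varphi(n)+1),\qquad 2(\varphi(n)-1)-\frac n2,\qquad -2-2\,c(r,n)\quad\Bigl(0<r<n,\ r\ne \frac n2\Bigr),$$ and the distance spectral radius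 is $\frac{5n}{2}-2(\varphi(n)+1)$. 3. The distance energy of $X_n$ is $$DE(X_n)=2n-2m+\varphi(n)\,2^{k+1}-(2+2\varphi(n))-(2\varphi(n)-2)+\Bigl(\frac{5n}{2}-2(\varphi(n)+1)\Bigr)+\Bigl|2(\varphi(n)-1)-\frac n2\Bigr|.$$ -/

import Mathlib

noncomputable section

namespace DistanceEnergy

/-- The distance matrix `[d(i, j)]` of a finite graph, with real entries. -/
def distMatrix {V : Type*} (G : SimpleGraph V) : Matrix V V ℝ :=
  Matrix.of fun i j => (G.dist i j : ℝ)

/-- The distance spectrum: the multiset of eigenvalues of the distance matrix, with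
multiplicities. The matrix is real symmetric, so that all the roots of its characteristic
polynomial are real. -/
def distSpectrum {V : Type*} [Fintype V] [DecidableEq V] (G : SimpleGraph V) : Multiset ℝ :=
  (distMatrix G).charpoly.roots

/-- The distance energy: the sum of the absolute values of the distance eigenvalues. -/
def distEnergy {V : Type*} [Fintype V] [DecidableEq V] (G : SimpleGraph V) : ℝ :=
  ((distSpectrum G).map fun μ => |μ|).sum

/-- The unitary Cayley graph `X n`: its vertices are the integers modulo `n`, and distinct
vertices `a`, `b` are adjacent if and only if `gcd (a - b, n) = 1`. -/
def unitaryCayley (n : ℕ) : SimpleGraph (ZMod n) :=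
  SimpleGraph.fromRel fun a b => Nat.gcd (a - b).val n = 1

/-- Ramanujan's sum `c(r, n)`: the sum of `exp (2 π i a r / n)` over the integers `1 ≤ a ≤ n`
that are coprime to `n`. -/
def ramanujanSum (r n : ℕ) : ℂ :=
  ∑ a ∈ (Finset.Icc 1 n).filter (fun a => Nat.gcd a n = 1),
    Complex.exp (2 * Real.pi * Complex.I / n * (a * r))

end DistanceEnergy

end

namespace DistanceEnergy
open Finset

/-! Since `n` is even, units are odd, so every edge changes parity; and every even class is a sum of
two units (`exists_isUnit_add_isUnit`). So a nonzero difference is at distance 1 if a unit, 2 if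
even, 3 otherwise: the profile is 3 - [2 ∣ i] - 2[gcd(i,n) = 1] - 2[i = 0]. The distance matrix is
circulant, its eigenvalues are the Fourier transform of this profile (`charpoly_of_sub`), and the
transform of the coprimality term is Ramanujan's sum c(r,n).

For the energy, let m be the radical of n and q = n/m. Then c(r,n) vanishes unless q ∣ r, and
c(qs,n) is q times the product over p ∣ n of p - 1 (if p ∣ s) or -1. These values are nonzero
integers, so |-2 - 2c| = 2|c| + 2 sign c. Over s mod m, absolute values and signs both sum to
products over primes; the sign sum is 0 because of the factor at p = 2. -/

/-! ### Distances and diameter. -/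

theorem isUnit_iff_gcd_val {n : ℕ} [NeZero n] (v : ZMod n) : IsUnit v ↔ Nat.gcd v.val n = 1 := by
  conv_lhs => rw [← ZMod.natCast_zmod_val v, ZMod.isUnit_iff_coprime]

theorem unitaryCayley_adj {n : ℕ} [NeZero n] (hn : 1 < n) (a b : ZMod n) :
    (unitaryCayley n).Adj a b ↔ IsUnit (b - a) := by
  have : Fact (1 < n) := ⟨hn⟩
  have hneg : IsUnit (a - b) ↔ IsUnit (b - a) := by rw [← neg_sub, IsUnit.neg_iff]
  rw [unitaryCayley, SimpleGraph.fromRel_adj, ← isUnit_iff_gcd_val, ← isUnit_iff_gcd_val, hneg,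
    or_self, and_iff_right_iff_imp]
  rintro h rfl
  simp at h

/-- Reduction modulo `2` of a residue class modulo an even number. -/
def parity {n : ℕ} (h : 2 ∣ n) : ZMod n →+* ZMod 2 := ZMod.castHom h (ZMod 2)

theorem parity_eq_val {n : ℕ} [NeZero n] (h : 2 ∣ n) (v : ZMod n) :
    parity h v = (v.val : ZMod 2) := by
  conv_lhs => rw [← ZMod.natCast_zmod_val v, map_natCast]

theorem parity_eq_zero_iff {n : ℕ} [NeZero n] (h : 2 ∣ n) (v : ZMod n) :
    parity h v = 0 ↔ Even v.val := by
  rw [parity_eq_val, ZMod.natCast_eq_zero_iff_even]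

theorem eq_one_of_ne_zero : ∀ x : ZMod 2, x ≠ 0 → x = 1 := by decide

theorem parity_isUnit {n : ℕ} (h : 2 ∣ n) {v : ZMod n} (hv : IsUnit v) : parity h v = 1 :=
  eq_one_of_ne_zero _ (hv.map (parity h)).ne_zero

theorem parity_walk {n : ℕ} [NeZero n] (hn : 1 < n) (h : 2 ∣ n) {a b : ZMod n}
    (p : (unitaryCayley n).Walk a b) : parity h (b - a) = (p.length : ZMod 2) := by
  induction p with
  | nil => simp
  | @cons u v w huv p ih =>
    have h1 := parity_isUnit h ((unitaryCayley_adj hn u v).1 huv)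
    rw [SimpleGraph.Walk.length_cons, Nat.cast_add, ← ih, Nat.cast_one, ← h1, ← map_add]
    congr 1
    ring

/-- By the Chinese remainder theorem it suffices to find, modulo each prime p ∣ n, a residue
avoiding 0 and v. For p = 2 these two coincide; for odd p there are at least three residues. -/
theorem exists_isUnit_add_isUnit {n : ℕ} [NeZero n] (h : 2 ∣ n) {v : ZMod n}
    (hv : parity h v = 0) : ∃ u w : ZMod n, IsUnit u ∧ IsUnit w ∧ v = u + w := by
  have hloc : ∀ p ∈ n.primeFactors, ∃ x : ℕ, ¬ p ∣ x ∧ ¬ (p : ℤ) ∣ (v.val : ℤ) - x := by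
    intro p hp
    have hpp := Nat.prime_of_mem_primeFactors hp
    have := Fact.mk hpp
    have key : ∃ x : ZMod p, x ≠ 0 ∧ ((v.val : ℕ) : ZMod p) - x ≠ 0 := by
      rcases hpp.eq_two_or_odd' with rfl | hodd
      · rw [parity_eq_val] at hv
        exact ⟨1, one_ne_zero, by rw [hv, zero_sub]; exact neg_ne_zero.2 one_ne_zero⟩
      -- The residue 1 works unless v ≡ 1; then -1 works, as v - (-1) = 2 ≠ 0 modulo an odd prime.
      · by_cases h1 : ((v.val : ℕ) : ZMod p) = 1
        · refine ⟨-1, neg_ne_zero.2 one_ne_zero, ?_⟩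
          rw [h1, sub_neg_eq_add, one_add_one_eq_two]
          intro h2
          have h3 : ((2 : ℕ) : ZMod p) = 0 := by exact_mod_cast h2
          rw [ZMod.natCast_eq_zero_iff, Nat.prime_dvd_prime_iff_eq hpp Nat.prime_two] at h3
          subst h3
          exact absurd hodd (by decide)
        · exact ⟨1, one_ne_zero, sub_ne_zero.2 h1⟩
    obtain ⟨x, hx0, hx1⟩ := key
    refine ⟨x.val, fun hd => hx0 ?_, fun hd => hx1 ?_⟩
    · rw [← ZMod.natCast_eq_zero_iff, ZMod.natCast_zmod_val] at hd
      exact hd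
    · rw [← ZMod.intCast_zmod_eq_zero_iff_dvd] at hd
      simpa using hd
  choose! x hx0 hx1 using hloc
  obtain ⟨k, hk⟩ := Nat.chineseRemainderOfFinset x id (t := n.primeFactors)
    (fun p hp => (Nat.prime_of_mem_primeFactors hp).ne_zero)
    (fun p hp q hq hpq => (Nat.coprime_primes (Nat.prime_of_mem_primeFactors hp)
      (Nat.prime_of_mem_primeFactors hq)).2 hpq)
  have hunit : ∀ z : ℤ, (∀ p ∈ n.primeFactors, ¬ (p : ℤ) ∣ z) → IsUnit (z : ZMod n) := by
    intro z hz
    rw [← ZMod.natCast_zmod_val (z : ZMod n), ZMod.isUnit_iff_coprime]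
    refine Nat.Coprime.symm (Nat.coprime_of_dvd fun p hp hpn hpz => ?_)
    refine hz p (Nat.mem_primeFactors.2 ⟨hp, hpn, NeZero.ne n⟩) ?_
    have h1 : (n : ℤ) ∣ z - ((z : ZMod n).val : ℕ) := by
      rw [← ZMod.intCast_zmod_eq_zero_iff_dvd]
      simp
    have h2 := dvd_add ((Int.natCast_dvd_natCast.2 hpn).trans h1) (Int.natCast_dvd_natCast.2 hpz)
    simpa using h2
  have hkx : ∀ p ∈ n.primeFactors, (p : ℤ) ∣ (x p : ℤ) - k := fun p hp =>
    (Nat.modEq_iff_dvd.1 (hk p hp))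
  refine ⟨((k : ℤ) : ZMod n), (((v.val : ℤ) - k : ℤ) : ZMod n), hunit _ ?_, hunit _ ?_, by simp⟩
  · intro p hp hd
    have := dvd_add (hkx p hp) hd
    rw [sub_add_cancel, Int.natCast_dvd_natCast] at this
    exact hx0 p hp this
  · intro p hp hd
    have := dvd_sub hd (hkx p hp)
    rw [sub_sub_sub_cancel_right] at this
    exact hx1 p hp this

theorem one_lt_of_two_dvd {n : ℕ} [NeZero n] (h : 2 ∣ n) : 1 < n :=
  Nat.le_of_dvd (NeZero.pos n) h

theorem exists_walk_two {n : ℕ} [NeZero n] (h : 2 ∣ n) {a b : ZMod n}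
    (hab : parity h (b - a) = 0) : ∃ p : (unitaryCayley n).Walk a b, p.length = 2 := by
  obtain ⟨u, w, hu, hw, huw⟩ := exists_isUnit_add_isUnit h hab
  have hn := one_lt_of_two_dvd h
  have h1 : (unitaryCayley n).Adj a (a + u) := by rw [unitaryCayley_adj hn]; simpa using hu
  have h2 : (unitaryCayley n).Adj (a + u) b := by
    rw [unitaryCayley_adj hn]
    have : b - (a + u) = w := by rw [← sub_sub, huw]; ring
    rwa [this]
  exact ⟨.cons h1 (.cons h2 .nil), rfl⟩

theorem exists_walk_three {n : ℕ} [NeZero n] (h : 2 ∣ n) {a b : ZMod n}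
    (hab : parity h (b - a) ≠ 0) : ∃ p : (unitaryCayley n).Walk a b, p.length = 3 := by
  have h1 : (unitaryCayley n).Adj a (a + 1) := by
    rw [unitaryCayley_adj (one_lt_of_two_dvd h)]; simp
  obtain ⟨p, hp⟩ := exists_walk_two h (a := a + 1) (b := b) (by
    rw [← sub_sub, map_sub, eq_one_of_ne_zero _ hab, map_one, sub_self])
  exact ⟨.cons h1 p, by simp [hp]⟩

theorem unitaryCayley_reachable {n : ℕ} [NeZero n] (h : 2 ∣ n) (a b : ZMod n) :
    (unitaryCayley n).Reachable a b := by
  by_cases hab : parity h (b - a) = 0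
  · exact ⟨(exists_walk_two h hab).choose⟩
  · exact ⟨(exists_walk_three h hab).choose⟩

theorem parity_dist {n : ℕ} [NeZero n] (h : 2 ∣ n) (a b : ZMod n) :
    parity h (b - a) = ((unitaryCayley n).dist a b : ZMod 2) := by
  obtain ⟨p, hp⟩ := (unitaryCayley_reachable h a b).exists_walk_length_eq_dist
  rw [← hp, parity_walk (one_lt_of_two_dvd h) h p]

theorem unitaryCayley_dist {n : ℕ} [NeZero n] (h : 2 ∣ n) (a b : ZMod n) :
    (unitaryCayley n).dist a b =
      if b - a = 0 then 0 else if IsUnit (b - a) then 1 else if Even (b - a).val then 2 else 3 := by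
  have hr := unitaryCayley_reachable h a b
  have hpar := parity_dist h a b
  split_ifs with h0 h1 h2
  · rw [hr.dist_eq_zero_iff, sub_eq_zero.1 h0]
  · rwa [SimpleGraph.dist_eq_one_iff_adj, unitaryCayley_adj (one_lt_of_two_dvd h)]
  all_goals
    have d0 : (unitaryCayley n).dist a b ≠ 0 := fun h' =>
      h0 (sub_eq_zero.2 (hr.dist_eq_zero_iff.1 h').symm)
    have d1 : (unitaryCayley n).dist a b ≠ 1 := fun h' =>
      h1 ((unitaryCayley_adj (one_lt_of_two_dvd h) a b).1 (SimpleGraph.dist_eq_one_iff_adj.1 h'))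
    rw [← parity_eq_zero_iff h] at h2
  · obtain ⟨p, hp⟩ := exists_walk_two h h2
    have := SimpleGraph.dist_le p
    omega
  · obtain ⟨p, hp⟩ := exists_walk_three h h2
    have := SimpleGraph.dist_le p
    have d2 : (unitaryCayley n).dist a b ≠ 2 := fun h' => h2 (by rw [hpar, h']; decide)
    omega

theorem unitaryCayley_diam {n : ℕ} [NeZero n] (h : 2 ∣ n)
    (hp : ∃ p : ℕ, p.Prime ∧ Odd p ∧ p ∣ n) : (unitaryCayley n).diam = 3 := by
  have hle : ∀ a b, (unitaryCayley n).dist a b ≤ 3 := by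
    intro a b
    rw [unitaryCayley_dist h]
    split_ifs <;> omega
  obtain ⟨p, hpp, hodd, hpn⟩ := hp
  have hlt : p < n := by
    refine lt_of_le_of_ne (Nat.le_of_dvd (NeZero.pos n) hpn) ?_
    rintro rfl
    exact (Nat.not_even_iff_odd.2 hodd) (even_iff_two_dvd.2 h)
  -- The odd prime divisor is itself a vertex that is odd, nonzero and not a unit.
  have h3 : (unitaryCayley n).dist 0 (p : ZMod n) = 3 := by
    have hval : (p : ZMod n).val = p := ZMod.val_cast_of_lt hlt
    rw [unitaryCayley_dist h, sub_zero, if_neg, if_neg, if_neg]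
    · rwa [hval, Nat.not_even_iff_odd]
    · rw [isUnit_iff_gcd_val, hval, Nat.gcd_eq_left hpn]
      exact hpp.one_lt.ne'
    · rw [ZMod.natCast_eq_zero_iff]
      exact Nat.not_dvd_of_pos_of_lt hpp.pos hlt
  have hconn : (unitaryCayley n).Connected := ⟨unitaryCayley_reachable h⟩
  refine le_antisymm ?_ ?_
  · obtain ⟨u, v, huv⟩ := (unitaryCayley n).exists_dist_eq_diam
    exact huv ▸ hle u v
  · rw [← h3]
    exact SimpleGraph.dist_le_diam (SimpleGraph.connected_iff_ediam_ne_top.1 hconn)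

/-! ### Sums of products indexed by prime divisibility. -/

theorem sum_range_ite_dvd {M : Type*} [AddCommMonoid M] {d N : ℕ} (hd : 0 < d) (h : d ∣ N)
    (f : ℕ → M) :
    ∑ a ∈ range N, (if d ∣ a then f a else 0) = ∑ b ∈ range (N / d), f (d * b) := by
  obtain ⟨e, rfl⟩ := h
  rw [Nat.mul_div_cancel_left _ hd, ← sum_filter]
  refine (sum_bij (fun b _ => d * b) ?_ ?_ ?_ fun _ _ => rfl).symm
  · intro b hb
    simpa using Nat.mul_lt_mul_of_pos_left (mem_range.1 hb) hd
  · intro a _ b _ hab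
    exact Nat.eq_of_mul_eq_mul_left hd hab
  · intro a ha
    obtain ⟨ha, b, rfl⟩ := mem_filter.1 ha
    exact ⟨b, mem_range.2 (Nat.lt_of_mul_lt_mul_left (mem_range.1 ha)), rfl⟩

theorem prod_primes_dvd_iff {S : Finset ℕ} (hS : ∀ p ∈ S, p.Prime) (s : ℕ) :
    ∏ p ∈ S, p ∣ s ↔ ∀ p ∈ S, p ∣ s :=
  ⟨fun h _ hp => (dvd_prod_of_mem _ hp).trans h,
    fun h => prod_primes_dvd s (fun p hp => (hS p hp).prime) h⟩

theorem prod_ite_prime_dvd {R : Type*} [CommRing R] {S : Finset ℕ} (hS : ∀ p ∈ S, p.Prime)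
    (f : ℕ → R) (s : ℕ) :
    ∏ p ∈ S, (if p ∣ s then f p else 0) = if ∏ p ∈ S, p ∣ s then ∏ p ∈ S, f p else 0 := by
  rw [prod_ite_zero]
  simp only [prod_primes_dvd_iff hS]

/-- Divisibility by distinct primes is independent on a full period, so the average of the product
is the product of the averages. Expanding over subsets S merges the conditions into ∏ S ∣ s, which
holds for N / ∏ S values of s. -/
theorem sum_range_prod_prime_dvd {K : Type*} [Field K] [CharZero K] {P : Finset ℕ}
    (hP : ∀ p ∈ P, p.Prime) {N : ℕ} (hN : ∏ p ∈ P, p ∣ N) (f g : ℕ → K) :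
    ∑ s ∈ range N, ∏ p ∈ P, ((if p ∣ s then f p else 0) + g p) =
      N * ∏ p ∈ P, (f p / p + g p) := by
  simp only [prod_add]
  rw [sum_comm, mul_sum]
  refine sum_congr rfl fun S hS => ?_
  rw [mem_powerset] at hS
  have hSp : ∀ p ∈ S, p.Prime := fun p hp => hP p (hS hp)
  have hd : ∏ p ∈ S, p ∣ N := (prod_dvd_prod_of_subset _ _ _ hS).trans hN
  have hpos : 0 < ∏ p ∈ S, p := prod_pos fun p hp => (hSp p hp).pos
  rw [← sum_mul, ← mul_assoc]
  congr 1
  simp only [prod_ite_prime_dvd hSp]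
  rw [sum_range_ite_dvd hpos hd (fun _ => ∏ p ∈ S, f p), sum_const, card_range, nsmul_eq_mul,
    Nat.cast_div hd (by exact_mod_cast hpos.ne'), prod_div_distrib, Nat.cast_prod]
  ring

/-! ### Ramanujan's sum. -/

/-- The value at `r` of the character of `ℤ / N` attached to `a`. -/
noncomputable def rootExp (N a r : ℕ) : ℂ := Complex.exp (2 * Real.pi * Complex.I / N * (a * r))

theorem rootExp_eq_pow (N a r : ℕ) :
    rootExp N a r = (Complex.exp (2 * Real.pi * Complex.I / N) ^ r) ^ a := by
  rw [rootExp, ← pow_mul, ← Complex.exp_nat_mul]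
  congr 1
  push_cast
  ring

theorem sum_rootExp {N : ℕ} (hN : N ≠ 0) (r : ℕ) :
    ∑ a ∈ range N, rootExp N a r = if N ∣ r then (N : ℂ) else 0 := by
  have hprim := Complex.isPrimitiveRoot_exp N hN
  simp only [rootExp_eq_pow]
  split_ifs with h
  · simp [(hprim.pow_eq_one_iff_dvd r).2 h]
  · have h1 : Complex.exp (2 * Real.pi * Complex.I / N) ^ r ≠ 1 := fun h' =>
      h ((hprim.pow_eq_one_iff_dvd r).1 h')
    rw [geom_sum_eq h1, ← pow_mul, mul_comm r, pow_mul, hprim.pow_eq_one, one_pow, sub_self,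
      zero_div]

theorem sum_rootExp_dvd {N d : ℕ} (hN : N ≠ 0) (h : d ∣ N) (r : ℕ) :
    ∑ a ∈ range N, (if d ∣ a then rootExp N a r else 0) =
      if N / d ∣ r then ((N / d : ℕ) : ℂ) else 0 := by
  have hd : 0 < d := Nat.pos_of_ne_zero fun h0 => hN (Nat.eq_zero_of_zero_dvd (h0 ▸ h))
  rw [sum_range_ite_dvd hd h, ← sum_rootExp (Nat.div_pos (Nat.le_of_dvd (by omega) h) hd).ne']
  refine sum_congr rfl fun b _ => ?_
  rw [rootExp, rootExp, Nat.cast_div h (by exact_mod_cast hd.ne')]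
  congr 1
  have : (d : ℂ) ≠ 0 := by exact_mod_cast hd.ne'
  have : (N : ℂ) ≠ 0 := by exact_mod_cast hN
  push_cast
  field_simp

theorem ramanujanSum_eq_sum_range {n : ℕ} (hn : 1 < n) (r : ℕ) :
    ramanujanSum r n = ∑ a ∈ range n, if Nat.gcd a n = 1 then rootExp n a r else 0 := by
  rw [ramanujanSum, ← sum_filter]
  refine sum_congr ?_ fun _ _ => rfl
  ext a
  -- The endpoints n and 0 both have gcd n > 1 with n, so neither index set counts its own endpoint.
  simp only [mem_filter, mem_Icc, mem_range]
  constructor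
  · rintro ⟨⟨h1, h2⟩, h3⟩
    refine ⟨lt_of_le_of_ne h2 ?_, h3⟩
    rintro rfl
    rw [Nat.gcd_self] at h3
    omega
  · rintro ⟨h1, h3⟩
    refine ⟨⟨Nat.pos_of_ne_zero ?_, h1.le⟩, h3⟩
    rintro rfl
    rw [Nat.gcd_zero_left] at h3
    omega

theorem gcd_eq_one_iff_forall_prime {n : ℕ} (hn : n ≠ 0) (a : ℕ) :
    Nat.gcd a n = 1 ↔ ∀ p ∈ n.primeFactors, ¬ p ∣ a := by
  constructor
  · intro h p hp hpa
    have := Nat.dvd_gcd hpa (Nat.dvd_of_mem_primeFactors hp)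
    rw [h] at this
    exact (Nat.prime_of_mem_primeFactors hp).one_lt.ne' (Nat.dvd_one.1 this)
  · intro h
    exact Nat.Coprime.symm (Nat.coprime_of_dvd fun p hp hpn hpa =>
      h p (Nat.mem_primeFactors.2 ⟨hp, hpn, hn⟩) hpa)

theorem ite_gcd_eq_one {n : ℕ} (hn : n ≠ 0) (a : ℕ) :
    (if Nat.gcd a n = 1 then (1 : ℂ) else 0) =
      ∏ p ∈ n.primeFactors, ((if p ∣ a then (-1 : ℂ) else 0) + 1) := by
  simp only [gcd_eq_one_iff_forall_prime hn]
  rw [← prod_const_one (s := n.primeFactors) (ι := ℕ), ← prod_ite_zero]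
  refine prod_congr rfl fun p _ => ?_
  split_ifs <;> simp_all

/-- Möbius inversion: with d = ∏ S running over the squarefree divisors of n, this is the sum of
μ(d) (n/d) [n/d ∣ r]. -/
theorem ramanujanSum_eq_sum_powerset {n : ℕ} (hn : 1 < n) (r : ℕ) :
    ramanujanSum r n = ∑ S ∈ n.primeFactors.powerset, (∏ _p ∈ S, (-1 : ℂ)) *
      if n / ∏ p ∈ S, p ∣ r then ((n / ∏ p ∈ S, p : ℕ) : ℂ) else 0 := by
  have hn0 : n ≠ 0 := by omega
  have hterm : ∀ a, (if Nat.gcd a n = 1 then rootExp n a r else 0) =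
      ∑ S ∈ n.primeFactors.powerset, (∏ _p ∈ S, (-1 : ℂ)) *
        if ∏ p ∈ S, p ∣ a then rootExp n a r else 0 := by
    intro a
    have : (if Nat.gcd a n = 1 then rootExp n a r else 0) =
        (if Nat.gcd a n = 1 then (1 : ℂ) else 0) * rootExp n a r := by split_ifs <;> simp
    rw [this, ite_gcd_eq_one hn0, prod_add, sum_mul]
    refine sum_congr rfl fun S hS => ?_
    rw [prod_ite_prime_dvd fun p hp => Nat.prime_of_mem_primeFactors (mem_powerset.1 hS hp)]
    split_ifs <;> simp
  rw [ramanujanSum_eq_sum_range hn]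
  simp only [hterm]
  rw [sum_comm]
  refine sum_congr rfl fun S hS => ?_
  rw [← mul_sum, sum_rootExp_dvd hn0]
  exact (prod_dvd_prod_of_subset _ _ _ (mem_powerset.1 hS)).trans (Nat.prod_primeFactors_dvd n)

/-- The integer `∏ (p - 1 or -1)`, where `p` runs over the prime divisors of `n` and the factor
is `p - 1` if `p` divides `s`. -/
def radFactor (n s : ℕ) : ℤ := ∏ p ∈ n.primeFactors, ((if p ∣ s then (p : ℤ) else 0) + -1)

/-- Here n / ∏ S is q times the product of the primes outside S, and it divides qs iff those primes
divide s; the sum over S then folds back into a product. -/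
theorem ramanujanSum_of_dvd {n q : ℕ} (hn : 1 < n) (hq : n = q * ∏ p ∈ n.primeFactors, p)
    (s : ℕ) : ramanujanSum (q * s) n = q * (radFactor n s : ℂ) := by
  have hq0 : 0 < q := Nat.pos_of_ne_zero fun h => by rw [h, zero_mul] at hq; omega
  rw [ramanujanSum_eq_sum_powerset hn, radFactor]
  push_cast
  simp only [add_comm _ (-1 : ℂ)]
  rw [prod_add, mul_sum]
  refine sum_congr rfl fun S hS => ?_
  rw [mem_powerset] at hS
  have hpos : 0 < ∏ p ∈ S, p :=
    prod_pos fun p hp => (Nat.prime_of_mem_primeFactors (hS hp)).pos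
  have hdiv : n / ∏ p ∈ S, p = q * ∏ p ∈ n.primeFactors \ S, p := by
    refine Nat.div_eq_of_eq_mul_left hpos ?_
    conv_lhs => rw [hq, ← prod_sdiff hS, ← mul_assoc]
  have hprod := prod_ite_prime_dvd (R := ℂ) (S := n.primeFactors \ S)
    (fun p hp => Nat.prime_of_mem_primeFactors (mem_sdiff.1 hp).1) (fun p => (p : ℂ)) s
  simp only [hprod, hdiv, Nat.mul_dvd_mul_iff_left hq0]
  split_ifs
  · push_cast
    ring
  · simp

/-- Each n / ∏ S is a multiple of q, so no term survives. -/
theorem ramanujanSum_of_not_dvd {n q : ℕ} (hn : 1 < n) (hq : n = q * ∏ p ∈ n.primeFactors, p)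
    {r : ℕ} (hr : ¬ q ∣ r) : ramanujanSum r n = 0 := by
  rw [ramanujanSum_eq_sum_powerset hn]
  refine sum_eq_zero fun S hS => ?_
  rw [mem_powerset] at hS
  have hpos : 0 < ∏ p ∈ S, p :=
    prod_pos fun p hp => (Nat.prime_of_mem_primeFactors (hS hp)).pos
  have hdiv : n / ∏ p ∈ S, p = q * ∏ p ∈ n.primeFactors \ S, p := by
    refine Nat.div_eq_of_eq_mul_left hpos ?_
    conv_lhs => rw [hq, ← prod_sdiff hS, ← mul_assoc]
  rw [hdiv, if_neg fun h => hr ((dvd_mul_right _ _).trans h), mul_zero]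

/-! ### Absolute values and signs of Ramanujan's sums. -/

theorem sum_abs_radFactor (n : ℕ) (h2 : ∀ p ∈ n.primeFactors, p.Prime) :
    ∑ s ∈ range (∏ p ∈ n.primeFactors, p), (|radFactor n s| : ℝ) =
      ∏ p ∈ n.primeFactors, (2 * ((p : ℝ) - 1)) := by
  -- The factor p - 1 or 1 is written [p ∣ s](p - 2) + 1, whose average is 2(p - 1)/p.
  have h : ∀ s, (|radFactor n s| : ℝ) =
      ∏ p ∈ n.primeFactors, ((if p ∣ s then (p : ℝ) - 2 else 0) + 1) := by
    intro s
    rw [radFactor, Int.cast_prod, abs_prod]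
    refine prod_congr rfl fun p hp => ?_
    have : (2 : ℝ) ≤ p := by exact_mod_cast (h2 p hp).two_le
    split_ifs
    · push_cast
      rw [abs_of_nonneg (by linarith)]
      ring
    · simp
  simp only [h]
  rw [sum_range_prod_prime_dvd h2 dvd_rfl, Nat.cast_prod, ← prod_mul_distrib]
  refine prod_congr rfl fun p hp => ?_
  have : (p : ℝ) ≠ 0 := by exact_mod_cast (h2 p hp).ne_zero
  field_simp
  ring

theorem sign_radFactor {n : ℕ} (h2 : ∀ p ∈ n.primeFactors, p.Prime) (s : ℕ) :
    (Int.sign (radFactor n s) : ℝ) =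
      ∏ p ∈ n.primeFactors, ((if p ∣ s then (2 : ℝ) else 0) + -1) := by
  have h : ∀ S ⊆ n.primeFactors,
      Int.sign (∏ p ∈ S, ((if p ∣ s then (p : ℤ) else 0) + -1)) =
        ∏ p ∈ S, ((if p ∣ s then (2 : ℤ) else 0) + -1) := by
    intro S
    induction S using Finset.induction_on with
    | empty => simp
    | insert p S hp ih =>
      intro hS
      rw [prod_insert hp, prod_insert hp, Int.sign_mul,
        ih ((subset_insert _ _).trans hS)]
      congr 1
      have := (h2 p (hS (mem_insert_self _ _))).two_le
      split_ifs
      · rw [Int.sign_eq_one_of_pos (by omega)]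
        rfl
      · rfl
  rw [radFactor, h _ subset_rfl]
  push_cast
  rfl

theorem radFactor_ne_zero {n : ℕ} (h2 : ∀ p ∈ n.primeFactors, p.Prime) (s : ℕ) :
    radFactor n s ≠ 0 := by
  refine prod_ne_zero_iff.2 fun p hp => ?_
  have := (h2 p hp).two_le
  split_ifs <;> omega

/-- The factor at p = 2 is +1 and -1 equally often, so it averages to 0. -/
theorem sum_sign_radFactor {n : ℕ} (h2 : ∀ p ∈ n.primeFactors, p.Prime)
    (he : 2 ∈ n.primeFactors) :
    ∑ s ∈ range (∏ p ∈ n.primeFactors, p), (Int.sign (radFactor n s) : ℝ) = 0 := by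
  simp only [sign_radFactor h2]
  rw [sum_range_prod_prime_dvd h2 dvd_rfl (fun _ => (2 : ℝ)) (fun _ => -1),
    mul_eq_zero]
  exact Or.inr (prod_eq_zero he (by norm_num))

/-- As |qF| ≥ 1, the sign of -2 - 2qF is governed by that of F; for F < 0 the value is nonnegative.
-/
theorem norm_neg_two_sub_two_mul {q : ℕ} (hq : 0 < q) {F : ℤ} (hF : F ≠ 0) :
    ‖(-2 - 2 * (q * F) : ℂ)‖ = 2 * q * |(F : ℝ)| + 2 * Int.sign F := by
  have h : (-2 - 2 * (q * F) : ℂ) = ((-2 - 2 * (q * F) : ℝ) : ℂ) := by push_cast; ring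
  have hq1 : (1 : ℝ) ≤ q := by exact_mod_cast hq
  rw [h, Complex.norm_real, Real.norm_eq_abs]
  rcases lt_or_gt_of_ne hF with h0 | h0
  · have h1 : (F : ℝ) ≤ -1 := by exact_mod_cast (by omega : F ≤ -1)
    rw [Int.sign_eq_neg_one_of_neg h0, abs_of_nonneg (by nlinarith), abs_of_neg (by linarith)]
    push_cast
    ring
  · have h1 : (1 : ℝ) ≤ F := by exact_mod_cast h0
    rw [Int.sign_eq_one_of_pos h0, abs_of_nonpos (by nlinarith), abs_of_pos (by linarith)]
    push_cast
    ring

theorem sum_norm_ramanujanSum {n : ℕ} (hn : 1 < n) (h2n : 2 ∣ n) :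
    ∑ r ∈ range n, ‖(-2 - 2 * ramanujanSum r n : ℂ)‖ =
      2 * (n : ℝ) - 2 * (∏ p ∈ n.primeFactors, (p : ℝ))
        + (n.totient : ℝ) * 2 ^ (n.primeFactors.card + 1) := by
  have h2 : ∀ p ∈ n.primeFactors, p.Prime := fun p hp => Nat.prime_of_mem_primeFactors hp
  have he : 2 ∈ n.primeFactors := Nat.mem_primeFactors.2 ⟨Nat.prime_two, h2n, by omega⟩
  obtain ⟨q, hq'⟩ := Nat.prod_primeFactors_dvd n
  have hq : n = q * ∏ p ∈ n.primeFactors, p := by rw [mul_comm, ← hq']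
  have hq0 : 0 < q := Nat.pos_of_ne_zero fun h => by rw [h, zero_mul] at hq; omega
  have hnq : n / q = ∏ p ∈ n.primeFactors, p := by
    conv_lhs => rw [hq, Nat.mul_div_cancel_left _ hq0]
  -- Where c(r,n) = 0 the norm is 2; splitting off this 2 leaves a sum over multiples of q.
  have hterm : ∀ r, ‖(-2 - 2 * ramanujanSum r n : ℂ)‖ =
      2 + if q ∣ r then ‖(-2 - 2 * ramanujanSum r n : ℂ)‖ - 2 else 0 := by
    intro r
    split_ifs with h
    · ring
    · rw [ramanujanSum_of_not_dvd hn hq h]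
      norm_num
  have htot : (n.totient : ℝ) = q * ∏ p ∈ n.primeFactors, ((p : ℝ) - 1) := by
    have h := Nat.totient_mul_prod_primeFactors n
    have hm : (∏ p ∈ n.primeFactors, p) ≠ 0 := prod_ne_zero_iff.2 fun p hp => (h2 p hp).ne_zero
    have h' : n.totient = q * ∏ p ∈ n.primeFactors, (p - 1) := by
      refine Nat.eq_of_mul_eq_mul_right (Nat.pos_of_ne_zero hm) ?_
      rw [h]
      conv_lhs => rw [hq]
      rw [mul_right_comm, ← hq]
    rw [h', Nat.cast_mul, Nat.cast_prod]
    congr 1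
    refine prod_congr rfl fun p hp => ?_
    rw [Nat.cast_sub (h2 p hp).one_le, Nat.cast_one]
  rw [sum_congr rfl fun r _ => hterm r, sum_add_distrib,
    sum_range_ite_dvd hq0 ⟨_, hq⟩ (fun r => ‖(-2 - 2 * ramanujanSum r n : ℂ)‖ - 2), hnq]
  simp only [ramanujanSum_of_dvd hn hq, norm_neg_two_sub_two_mul hq0 (radFactor_ne_zero h2 _)]
  rw [sum_sub_distrib, sum_add_distrib, ← mul_sum, ← mul_sum, sum_abs_radFactor n h2,
    sum_sign_radFactor h2 he, htot, prod_mul_distrib, prod_const]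
  simp only [sum_const, card_range, nsmul_eq_mul, Nat.cast_prod]
  ring

/-! ### The distance profile and the sizes of the spheres. -/

/-- The distance from `0` to the class of `i` in the unitary Cayley graph of even order `n`. -/
def distProfile (n i : ℕ) : ℕ :=
  if i = 0 then 0 else if Nat.gcd i n = 1 then 1 else if Even i then 2 else 3

theorem unitaryCayley_dist_eq_distProfile {n : ℕ} [NeZero n] (h : 2 ∣ n) (a b : ZMod n) :
    (unitaryCayley n).dist a b = distProfile n (b - a).val := by
  simp only [unitaryCayley_dist h, distProfile, isUnit_iff_gcd_val, ZMod.val_eq_zero]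

theorem odd_of_gcd_eq_one {n i : ℕ} (h : 2 ∣ n) (hi : Nat.gcd i n = 1) : ¬ 2 ∣ i := fun h' =>
  absurd (hi ▸ Nat.dvd_gcd h' h) (by decide)

theorem distProfile_eq {R : Type*} [CommRing R] {n : ℕ} (h : 2 ∣ n) (i : ℕ) :
    (distProfile n i : R) = 3 - (if 2 ∣ i then 1 else 0) - 2 * (if Nat.gcd i n = 1 then 1 else 0)
      - 2 * (if i = 0 then 1 else 0) := by
  have := @odd_of_gcd_eq_one n i h
  unfold distProfile
  simp only [even_iff_two_dvd]
  by_cases h0 : i = 0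
  · subst h0
    have : Nat.gcd 0 n ≠ 1 := fun h' => odd_of_gcd_eq_one h h' (dvd_zero 2)
    simp only [this, if_true, if_false, dvd_zero]
    norm_num
  split_ifs <;> first | exact absurd ‹2 ∣ i› (this ‹_›) | norm_num

theorem image_val_univ (n : ℕ) [NeZero n] : (univ : Finset (ZMod n)).image ZMod.val = range n := by
  ext i
  simp only [mem_image, mem_univ, true_and, mem_range]
  exact ⟨by rintro ⟨v, rfl⟩; exact ZMod.val_lt v, fun h => ⟨i, ZMod.val_cast_of_lt h⟩⟩

theorem map_val_univ (n : ℕ) [NeZero n] :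
    (univ : Finset (ZMod n)).val.map ZMod.val = (range n).val := by
  rw [← image_val_univ, image_val_of_injOn (ZMod.val_injective n).injOn]

theorem sum_zmod_val {M : Type*} [AddCommMonoid M] {n : ℕ} [NeZero n] (f : ℕ → M) :
    ∑ v : ZMod n, f v.val = ∑ i ∈ range n, f i := by
  rw [← image_val_univ, sum_image (ZMod.val_injective n).injOn]

theorem ncard_zmod_val {n : ℕ} [NeZero n] (P : ℕ → Prop) [DecidablePred P] :
    {v : ZMod n | P v.val}.ncard = ∑ i ∈ range n, if P i then 1 else 0 := by
  rw [← sum_zmod_val (fun i => if P i then 1 else 0), ← card_filter, ← Set.ncard_coe_finset]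
  simp

theorem card_gcd_eq_one (n : ℕ) :
    ∑ i ∈ range n, (if Nat.gcd i n = 1 then 1 else 0) = n.totient := by
  rw [← card_filter, Nat.totient]
  simp only [Nat.Coprime, Nat.gcd_comm]

theorem sum_range_even {R : Type*} [Field R] [CharZero R] {n : ℕ} (h : 2 ∣ n) :
    ∑ i ∈ range n, (if 2 ∣ i then (1 : R) else 0) = (n : R) / 2 := by
  rw [sum_range_ite_dvd two_pos h (fun _ => (1 : R)), sum_const, card_range, nsmul_one,
    Nat.cast_div h (by norm_num), Nat.cast_ofNat]

theorem sum_range_gcd_eq_one (R : Type*) [CommRing R] (n : ℕ) :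
    ∑ i ∈ range n, (if Nat.gcd i n = 1 then (1 : R) else 0) = n.totient := by
  rw [← card_gcd_eq_one]
  push_cast
  rfl

theorem ncard_dist_eq {n : ℕ} [NeZero n] (h : 2 ∣ n) (k : ℕ) :
    {v : ZMod n | (unitaryCayley n).dist 0 v = k}.ncard =
      ∑ i ∈ range n, if distProfile n i = k then 1 else 0 := by
  simp only [unitaryCayley_dist_eq_distProfile h, sub_zero]
  exact ncard_zmod_val fun i => distProfile n i = k

theorem ncard_dist_one {n : ℕ} [NeZero n] (h : 2 ∣ n) :
    {v : ZMod n | (unitaryCayley n).dist 0 v = 1}.ncard = n.totient := by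
  rw [ncard_dist_eq h, ← card_gcd_eq_one]
  refine sum_congr rfl fun i _ => ?_
  have := @odd_of_gcd_eq_one n i h
  refine if_congr ?_ rfl rfl
  unfold distProfile
  split_ifs <;> simp_all

theorem ncard_dist_two {n : ℕ} [NeZero n] (h : 2 ∣ n) :
    ({v : ZMod n | (unitaryCayley n).dist 0 v = 2}.ncard : ℝ) = (n : ℝ) / 2 - 1 := by
  have hterm : ∀ i, (if distProfile n i = 2 then (1 : ℝ) else 0) =
      (if 2 ∣ i then (1 : ℝ) else 0) - if i = 0 then 1 else 0 := by
    intro i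
    have := @odd_of_gcd_eq_one n i h
    simp only [distProfile, even_iff_two_dvd]
    split_ifs <;> simp_all
  rw [ncard_dist_eq h]
  push_cast
  simp only [hterm]
  rw [sum_sub_distrib, sum_range_even h, sum_ite_eq', if_pos (mem_range.2 (NeZero.pos n))]

theorem ncard_dist_three {n : ℕ} [NeZero n] (h : 2 ∣ n) :
    ({v : ZMod n | (unitaryCayley n).dist 0 v = 3}.ncard : ℝ) =
      (n : ℝ) / 2 - (n.totient : ℝ) := by
  have hterm : ∀ i, (if distProfile n i = 3 then (1 : ℝ) else 0) =
      1 - (if 2 ∣ i then (1 : ℝ) else 0) - if Nat.gcd i n = 1 then 1 else 0 := by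
    intro i
    have := @odd_of_gcd_eq_one n i h
    simp only [distProfile, even_iff_two_dvd]
    split_ifs <;> simp_all
  rw [ncard_dist_eq h]
  push_cast
  simp only [hterm]
  rw [sum_sub_distrib, sum_sub_distrib, sum_range_even h, sum_range_gcd_eq_one, sum_const,
    card_range, nsmul_one]
  ring

/-! ### Fourier diagonalization of circulant matrices. -/

theorem stdAddChar_mul {n : ℕ} [NeZero n] (v r : ZMod n) :
    ZMod.stdAddChar (v * r) = rootExp n v.val r.val := by
  have h := ZMod.stdAddChar_coe (N := n) ((v.val : ℤ) * r.val)
  push_cast at h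
  rw [ZMod.natCast_zmod_val, ZMod.natCast_zmod_val] at h
  rw [h, rootExp]
  congr 1
  ring

open Polynomial in
-- The characters are eigenvectors, forming the columns of `F`; orthogonality of characters makes
-- `F'` its inverse.
theorem charpoly_of_sub {n : ℕ} [NeZero n] (g : ZMod n → ℂ) :
    (Matrix.of fun i j : ZMod n => g (j - i)).charpoly =
      ∏ r : ZMod n, (X - C (∑ v : ZMod n, g v * ZMod.stdAddChar (v * r))) := by
  set A : Matrix (ZMod n) (ZMod n) ℂ := Matrix.of fun i j => g (j - i)
  set l : ZMod n → ℂ := fun r => ∑ v : ZMod n, g v * ZMod.stdAddChar (v * r)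
  set F : Matrix (ZMod n) (ZMod n) ℂ := Matrix.of fun i r => ZMod.stdAddChar (i * r)
  set F' : Matrix (ZMod n) (ZMod n) ℂ :=
    Matrix.of fun r j => (n : ℂ)⁻¹ * ZMod.stdAddChar (-(r * j))
  have hn : (n : ℂ) ≠ 0 := NeZero.ne _
  have hAF : A * F = F * Matrix.diagonal l := by
    ext i r
    rw [Matrix.mul_diagonal, Matrix.mul_apply]
    simp only [A, F, l, Matrix.of_apply]
    rw [mul_sum, ← Equiv.sum_comp (Equiv.addRight i)]
    refine sum_congr rfl fun v _ => ?_
    rw [Equiv.coe_addRight, add_sub_cancel_right, add_mul, AddChar.map_add_eq_mul]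
    ring
  have hFF : F * F' = 1 := by
    ext i j
    rw [Matrix.mul_apply, Matrix.one_apply]
    have h := AddChar.sum_mulShift (i - j) (ZMod.isPrimitive_stdAddChar n)
    simp only [F, F', Matrix.of_apply]
    have h' : ∀ r : ZMod n, (ZMod.stdAddChar (i * r) : ℂ) *
        ((n : ℂ)⁻¹ * ZMod.stdAddChar (-(r * j))) = (n : ℂ)⁻¹ * ZMod.stdAddChar (r * (i - j)) := by
      intro r
      rw [mul_left_comm, ← AddChar.map_add_eq_mul]
      congr 2
      ring
    simp only [h']
    rw [← mul_sum, h, ZMod.card]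
    simp only [sub_eq_zero]
    split_ifs <;> simp [hn]
  have hA : A = F * (Matrix.diagonal l * F') := by
    rw [← mul_assoc, ← hAF, mul_assoc, hFF, mul_one]
  rw [hA, Matrix.charpoly_mul_comm, mul_assoc, mul_eq_one_comm.1 hFF, mul_one,
    Matrix.charpoly_diagonal]

/-- The eigenvalue of the distance matrix that belongs to the character `r`. -/
noncomputable def distEigenvalue (n r : ℕ) : ℂ :=
  ∑ i ∈ range n, (distProfile n i : ℂ) * rootExp n i r

/-- The matrix is real symmetric, so its characteristic polynomial splits over ℝ and passing to ℂ
adds no roots. -/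
theorem distSpectrum_map_ofReal {n : ℕ} [NeZero n] (h : 2 ∣ n) :
    (distSpectrum (unitaryCayley n)).map (fun μ : ℝ => (μ : ℂ)) =
      (range n).val.map (distEigenvalue n) := by
  have hherm : (distMatrix (unitaryCayley n)).IsHermitian := by
    ext i j
    simp [distMatrix, SimpleGraph.dist_comm]
  have h1 := hherm.splits_charpoly.roots_map Complex.ofRealHom
  have h2 : (distMatrix (unitaryCayley n)).map Complex.ofRealHom =
      Matrix.of fun i j : ZMod n => (fun v : ZMod n => (distProfile n v.val : ℂ)) (j - i) := by
    ext i j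
    simp [distMatrix, unitaryCayley_dist_eq_distProfile h]
  have h3 : ∀ r : ZMod n, ∑ v : ZMod n, (distProfile n v.val : ℂ) * ZMod.stdAddChar (v * r) =
      distEigenvalue n r.val := by
    intro r
    simp only [stdAddChar_mul]
    exact sum_zmod_val fun i => (distProfile n i : ℂ) * rootExp n i r.val
  rw [← Matrix.charpoly_map, h2,
    charpoly_of_sub (fun v : ZMod n => (distProfile n v.val : ℂ))] at h1
  simp only [h3] at h1
  rw [Polynomial.roots_prod _ _ (prod_ne_zero_iff.2 fun r _ => Polynomial.X_sub_C_ne_zero _)] at h1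
  simp only [Polynomial.roots_X_sub_C, Multiset.bind_singleton] at h1
  rw [← map_val_univ, Multiset.map_map]
  exact h1.symm

/-! ### The eigenvalues. -/

theorem distEigenvalue_eq {n : ℕ} (h : 2 ∣ n) (hn : 1 < n) (r : ℕ) :
    distEigenvalue n r = 3 * (if n ∣ r then (n : ℂ) else 0) - (if n / 2 ∣ r then (n : ℂ) / 2 else 0)
      - 2 * ramanujanSum r n - 2 := by
  have h0 : rootExp n 0 r = 1 := by simp [rootExp]
  have hd := sum_rootExp_dvd (by omega) h r
  rw [Nat.cast_div h (by norm_num), Nat.cast_ofNat] at hd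
  rw [distEigenvalue, ramanujanSum_eq_sum_range hn, ← sum_rootExp (by omega) r, ← hd]
  simp only [distProfile_eq h, sub_mul, mul_assoc, ite_mul, one_mul, zero_mul]
  rw [sum_sub_distrib, sum_sub_distrib, sum_sub_distrib, ← mul_sum, ← mul_sum, ← mul_sum,
    sum_ite_eq', if_pos (mem_range.2 (by omega)), h0]
  ring

theorem ramanujanSum_zero {n : ℕ} (hn : 1 < n) : ramanujanSum 0 n = n.totient := by
  rw [ramanujanSum_eq_sum_range hn, ← sum_range_gcd_eq_one]
  simp [rootExp]

/-- At r = n/2 the character is a ↦ (-1)^a, and every a coprime to n is odd. -/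
theorem ramanujanSum_half {n : ℕ} (h : 2 ∣ n) (hn : 1 < n) :
    ramanujanSum (n / 2) n = -n.totient := by
  rw [ramanujanSum_eq_sum_range hn, ← sum_range_gcd_eq_one, ← sum_neg_distrib]
  refine sum_congr rfl fun a _ => ?_
  split_ifs with ha
  · have hodd : Odd a := by
      rw [← Nat.not_even_iff_odd, even_iff_two_dvd]
      exact odd_of_gcd_eq_one h ha
    have hn0 : (n : ℂ) ≠ 0 := by exact_mod_cast (by omega : n ≠ 0)
    rw [rootExp, Nat.cast_div h (by norm_num), Nat.cast_ofNat]
    have : 2 * Real.pi * Complex.I / n * (a * (n / 2)) = a * (Real.pi * Complex.I) := by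
      field_simp
    rw [this, Complex.exp_nat_mul, Complex.exp_pi_mul_I, hodd.neg_one_pow]
  · simp

theorem distEigenvalue_zero {n : ℕ} (h : 2 ∣ n) (hn : 1 < n) :
    distEigenvalue n 0 = 5 * (n : ℂ) / 2 - 2 * ((n.totient : ℂ) + 1) := by
  rw [distEigenvalue_eq h hn, ramanujanSum_zero hn]
  simp only [dvd_zero, if_true]
  ring

theorem distEigenvalue_half {n : ℕ} (h : 2 ∣ n) (hn : 1 < n) :
    distEigenvalue n (n / 2) = 2 * ((n.totient : ℂ) - 1) - (n : ℂ) / 2 := by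
  rw [distEigenvalue_eq h hn, ramanujanSum_half h hn, if_neg, if_pos dvd_rfl]
  · ring
  · exact Nat.not_dvd_of_pos_of_lt (by omega) (by omega)

theorem distEigenvalue_of_ne {n r : ℕ} (h : 2 ∣ n) (hn : 1 < n) (hr : r < n) (h0 : r ≠ 0)
    (h2 : r ≠ n / 2) : distEigenvalue n r = -2 - 2 * ramanujanSum r n := by
  rw [distEigenvalue_eq h hn, if_neg, if_neg]
  · ring
  · rintro ⟨k, rfl⟩
    have hk : k < 2 := by
      by_contra hk
      have := Nat.mul_le_mul_left (n / 2) (not_lt.1 hk)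
      omega
    interval_cases k <;> simp at h0 h2
  · exact Nat.not_dvd_of_pos_of_lt (by omega) hr

theorem range_eq_insert_insert {n : ℕ} (hn : 1 < n) :
    range n = insert 0 (insert (n / 2) ((range n).filter fun r => r ≠ 0 ∧ r ≠ n / 2)) := by
  ext r
  simp only [mem_insert, mem_filter, mem_range]
  omega

theorem distSpectrum_eq {n : ℕ} [NeZero n] (h : 2 ∣ n) :
    (distSpectrum (unitaryCayley n)).map (fun μ : ℝ => (μ : ℂ)) =
      (5 * (n : ℂ) / 2 - 2 * ((n.totient : ℂ) + 1)) ::ₘ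
      (2 * ((n.totient : ℂ) - 1) - (n : ℂ) / 2) ::ₘ
      ((range n).filter (fun r => r ≠ 0 ∧ r ≠ n / 2)).val.map
        (fun r => -2 - 2 * ramanujanSum r n) := by
  have hn := one_lt_of_two_dvd h
  rw [distSpectrum_map_ofReal h, range_eq_insert_insert hn, insert_val_of_notMem,
    insert_val_of_notMem, Multiset.map_cons, Multiset.map_cons, distEigenvalue_zero h hn,
    distEigenvalue_half h hn, ← range_eq_insert_insert hn]
  · congr 2
    refine Multiset.map_congr rfl fun r hr => ?_
    rw [mem_val, mem_filter, mem_range] at hr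
    exact distEigenvalue_of_ne h hn hr.1 hr.2.1 hr.2.2
  · simp
  · simp only [mem_insert, mem_filter, mem_range]
    omega

/-! ### Spectral radius and energy. -/

theorem norm_rootExp (N a r : ℕ) : ‖rootExp N a r‖ = 1 := by
  have : 2 * Real.pi * Complex.I / N * (a * r) =
      ((2 * Real.pi / N * (a * r) : ℝ) : ℂ) * Complex.I := by push_cast; ring
  rw [rootExp, this, Complex.norm_exp_ofReal_mul_I]

theorem sum_distProfile {n : ℕ} (h : 2 ∣ n) (hn : 1 < n) :
    ∑ i ∈ range n, (distProfile n i : ℝ) = 5 * (n : ℝ) / 2 - 2 * ((n.totient : ℝ) + 1) := by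
  have h0 := distEigenvalue_zero h hn
  simp only [distEigenvalue, rootExp, Nat.cast_zero, mul_zero, Complex.exp_zero, mul_one] at h0
  have h1 : ((∑ i ∈ range n, (distProfile n i : ℝ) : ℝ) : ℂ) =
      ((5 * (n : ℝ) / 2 - 2 * ((n.totient : ℝ) + 1) : ℝ) : ℂ) := by
    push_cast
    exact h0
  exact Complex.ofReal_injective h1

/-- Triangle inequality: the bound is the common row sum, which is the eigenvalue at r = 0. -/
theorem norm_distEigenvalue_le {n : ℕ} (h : 2 ∣ n) (hn : 1 < n) (r : ℕ) :
    ‖distEigenvalue n r‖ ≤ 5 * (n : ℝ) / 2 - 2 * ((n.totient : ℝ) + 1) := by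
  rw [← sum_distProfile h hn]
  refine (norm_sum_le _ _).trans_eq (sum_congr rfl fun i _ => ?_)
  rw [norm_mul, norm_rootExp, mul_one, Complex.norm_natCast]

theorem norm_distEigenvalue_zero {n : ℕ} (h : 2 ∣ n) (hn : 1 < n) :
    ‖(5 * (n : ℂ) / 2 - 2 * ((n.totient : ℂ) + 1))‖ =
      5 * (n : ℝ) / 2 - 2 * ((n.totient : ℝ) + 1) := by
  have hc : (5 * (n : ℂ) / 2 - 2 * ((n.totient : ℂ) + 1)) =
      ((5 * (n : ℝ) / 2 - 2 * ((n.totient : ℝ) + 1) : ℝ) : ℂ) := by push_cast; rfl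
  rw [hc, Complex.norm_real, Real.norm_eq_abs, abs_of_nonneg]
  rw [← sum_distProfile h hn]
  positivity

theorem isGreatest_abs_distSpectrum {n : ℕ} [NeZero n] (h : 2 ∣ n) :
    IsGreatest {x : ℝ | ∃ μ ∈ distSpectrum (unitaryCayley n), x = |μ|}
      (5 * (n : ℝ) / 2 - 2 * ((n.totient : ℝ) + 1)) := by
  have hn := one_lt_of_two_dvd h
  constructor
  · have hmem : (5 * (n : ℂ) / 2 - 2 * ((n.totient : ℂ) + 1)) ∈
        (distSpectrum (unitaryCayley n)).map (fun μ : ℝ => (μ : ℂ)) := by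
      rw [distSpectrum_eq h]
      exact Multiset.mem_cons_self _ _
    obtain ⟨μ, hμ, hμ'⟩ := Multiset.mem_map.1 hmem
    refine ⟨μ, hμ, ?_⟩
    rw [← norm_distEigenvalue_zero h hn, ← hμ', Complex.norm_real, Real.norm_eq_abs]
  · rintro x ⟨μ, hμ, rfl⟩
    have hmem := Multiset.mem_map_of_mem (fun μ : ℝ => (μ : ℂ)) hμ
    rw [distSpectrum_map_ofReal h] at hmem
    obtain ⟨r, -, hr⟩ := Multiset.mem_map.1 hmem
    rw [← Real.norm_eq_abs, ← Complex.norm_real, ← hr]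
    exact norm_distEigenvalue_le h hn r

theorem distEnergy_eq {n : ℕ} [NeZero n] (h : 2 ∣ n) :
    distEnergy (unitaryCayley n) =
      2 * (n : ℝ) - 2 * (∏ p ∈ n.primeFactors, (p : ℝ))
        + (n.totient : ℝ) * 2 ^ (n.primeFactors.card + 1)
        - (2 + 2 * (n.totient : ℝ)) - (2 * (n.totient : ℝ) - 2)
        + (5 * (n : ℝ) / 2 - 2 * ((n.totient : ℝ) + 1))
        + |2 * ((n.totient : ℝ) - 1) - (n : ℝ) / 2| := by
  have hn := one_lt_of_two_dvd h
  have hE : distEnergy (unitaryCayley n) =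
      (((distSpectrum (unitaryCayley n)).map (fun μ : ℝ => (μ : ℂ))).map fun z => ‖z‖).sum := by
    simp only [distEnergy, Multiset.map_map, Function.comp_def, Complex.norm_real,
      Real.norm_eq_abs]
  have hsum := sum_norm_ramanujanSum hn h
  have hφ : (1 : ℝ) ≤ n.totient := by exact_mod_cast Nat.totient_pos.2 (by omega)
  have h1 : ‖(-2 - 2 * ramanujanSum 0 n : ℂ)‖ = 2 + 2 * (n.totient : ℝ) := by
    have hc : (-2 - 2 * (n.totient : ℂ)) = ((-(2 + 2 * (n.totient : ℝ)) : ℝ) : ℂ) := by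
      push_cast; ring
    rw [ramanujanSum_zero hn, hc, Complex.norm_real, norm_neg, Real.norm_of_nonneg (by positivity)]
  have h2 : ‖(-2 - 2 * ramanujanSum (n / 2) n : ℂ)‖ = 2 * (n.totient : ℝ) - 2 := by
    have hc : (-2 - 2 * -(n.totient : ℂ)) = ((2 * (n.totient : ℝ) - 2 : ℝ) : ℂ) := by
      push_cast; ring
    rw [ramanujanSum_half h hn, hc, Complex.norm_real, Real.norm_of_nonneg (by linarith)]
  have h3 : ‖(2 * ((n.totient : ℂ) - 1) - (n : ℂ) / 2)‖ =
      |2 * ((n.totient : ℝ) - 1) - (n : ℝ) / 2| := by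
    rw [← Real.norm_eq_abs, ← Complex.norm_real]
    push_cast
    rfl
  -- The sum of |-2 - 2c(r,n)| over all r includes r = 0 and r = n/2, where the eigenvalues differ;
  -- these two terms are removed and the true ones added.
  rw [range_eq_insert_insert hn, sum_insert, sum_insert, h1, h2] at hsum
  · rw [hE, distSpectrum_eq h, Multiset.map_cons, Multiset.map_cons, Multiset.sum_cons,
      Multiset.sum_cons, Multiset.map_map, norm_distEigenvalue_zero h hn, h3]
    change _ + (_ + ∑ r ∈ (range n).filter (fun r => r ≠ 0 ∧ r ≠ n / 2),
      ‖(-2 - 2 * ramanujanSum r n : ℂ)‖) = _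
    linarith
  · simp
  · simp only [mem_insert, mem_filter, mem_range]
    omega

end DistanceEnergy

theorem mainTheorem3 (n : ℕ) [NeZero n] (hn : Even n)
    (hp : ∃ p : ℕ, p.Prime ∧ Odd p ∧ p ∣ n) :
    -- the diameter, and the numbers of vertices at distance 1, 2, 3 from the vertex 0
    (DistanceEnergy.unitaryCayley n).diam = 3 ∧
    {v : ZMod n | (DistanceEnergy.unitaryCayley n).dist 0 v = 1}.ncard = n.totient ∧
    ({v : ZMod n | (DistanceEnergy.unitaryCayley n).dist 0 v = 2}.ncard : ℝ) =
      (n : ℝ) / 2 - 1 ∧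
    ({v : ZMod n | (DistanceEnergy.unitaryCayley n).dist 0 v = 3}.ncard : ℝ) =
      (n : ℝ) / 2 - (n.totient : ℝ) ∧
    -- the distance spectrum, with multiplicities, as a multiset of complex numbers
    (DistanceEnergy.distSpectrum (DistanceEnergy.unitaryCayley n)).map (fun μ : ℝ => (μ : ℂ)) =
      (5 * (n : ℂ) / 2 - 2 * ((n.totient : ℂ) + 1)) ::ₘ
      (2 * ((n.totient : ℂ) - 1) - (n : ℂ) / 2) ::ₘ
      ((Finset.range n).filter (fun r => r ≠ 0 ∧ r ≠ n / 2)).val.map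
        (fun r => -2 - 2 * DistanceEnergy.ramanujanSum r n) ∧
    -- the distance spectral radius
    IsGreatest {x : ℝ | ∃ μ ∈ DistanceEnergy.distSpectrum (DistanceEnergy.unitaryCayley n),
        x = |μ|}
      (5 * (n : ℝ) / 2 - 2 * ((n.totient : ℝ) + 1)) ∧
    -- the distance energy
    DistanceEnergy.distEnergy (DistanceEnergy.unitaryCayley n) =
      2 * (n : ℝ) - 2 * (∏ p ∈ n.primeFactors, (p : ℝ))
        + (n.totient : ℝ) * 2 ^ (n.primeFactors.card + 1)
        - (2 + 2 * (n.totient : ℝ)) - (2 * (n.totient : ℝ) - 2)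
        + (5 * (n : ℝ) / 2 - 2 * ((n.totient : ℝ) + 1))
        + |2 * ((n.totient : ℝ) - 1) - (n : ℝ) / 2| := by
  have h : 2 ∣ n := hn.two_dvd
  exact ⟨DistanceEnergy.unitaryCayley_diam h hp, DistanceEnergy.ncard_dist_one h,
    DistanceEnergy.ncard_dist_two h, DistanceEnergy.ncard_dist_three h,
    DistanceEnergy.distSpectrum_eq h, DistanceEnergy.isGreatest_abs_distSpectrum h,
    DistanceEnergy.distEnergy_eq h⟩
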